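/- **Notation.** Terms are taken up to renaming of bound variables. Suprema and infima of distances are taken in $[0,1]$, so $\sup\emptyset=0$ and $\inf\emptyset=1$; also $2^{-\infty}=0$. For a preordered set $X$, $\mathrm{Ide}(X)$ is the set of ideals of $X$, i.e. nonempty directed lower subsets, ordered by inclusion. *Böhm trees.* Let $\mathcal A$ be the set of partial terms, i.e. $\lambda$-terms with a constant $\bot$ that are normal for $\beta$ and for $\lambda x.\bot\to\bot$, $\bot M\to\bot$; thus a partial term is $\bot$ or $\lambda x_1\dots x_n.\,y A_1\cdots A_k$ with $A_i\in\mathcal A$. It is ordered by the contextual closure (reflexive and transitive) $\preceq$ of $\bot\preceq A$. Put $h(\bot)=0$ and $h(\lambda\vec x.\,yA_1\cdots A_k)=1+\max_i h(A_i)$ (with $\max\emptyset=0$). The truncation is $A|_0=\bot$, $\bot|_n=\bot$, $(\lambda\vec x.\,yA_1\cdots A_k)|_{n+1}=\lambda\vec x.\,y(A_1|_n)\cdots(A_k|_n)$. Böhm trees are identified with the elements $\alpha$ of $\mathrm{Ide}(\mathcal A)$; the empty tree is $\{\bot\}$. Let $|\alpha|=\sup_{A\in\alpha}h(A)\in\mathbb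 N\cup\{\infty\}$ and, for $n\le|\alpha|$, $\alpha_n=\{A|_n\mid A\in\alpha\}$ (undefined for $n>|\alpha|$). Write $\alpha_n\triangleq\beta_n$ if both are defined and equal. The tree partial metric is $p_{\mathrm{tree}}(\alpha,\beta)=2^{-\mathrm{div}(\alpha,\beta)}$, where $\mathrm{div}(\alpha,\beta)=\inf\{n\in\mathbb N\mid \alpha_n\triangleq\beta_n \text{ and not } \alpha_{n+1}\triangleq\beta_{n+1}\}\in\mathbb N\cup\{\infty\}$, with $\inf\emptyset=\infty$ here. *Resource terms.* Let $\Lambda^r$ be the set of resource terms $t::=x\mid\lambda x.t\mid t\langle t,\dots,t\rangle$, where $\langle\cdots\rangle$ is a finite multiset (possibly empty), ordered by the contextual closure (reflexive and transitive) $\preceq$ of $\emptyset\preceq\langle t_1,\dots,t_n\rangle$. The height is $h(x)=1$, $h(\lambda x.t)=h(t)$, $h(t\langle u_1,\dots,u_m\rangle)=\max\{h(t),1+\max_i h(u_i)\}$ (with $\max\emptyset=0$). For $n\ge1$ the truncation is $x|_n=x$, $(\lambda x.t)|_n=\lambda x.(t|_n)$, $(t\,b)|_1=(t|_1)\,\emptyset$,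 and $(t\langle u_1,\dots,u_m\rangle)|_n=(t|_n)\langle u_1|_{n-1},\dots,u_m|_{n-1}\rangle$ for $n\ge2$. The resource distance is $r(t,u)=\inf\{2^{-n}\mid n\ge1,\ h(t),h(u)\ge n,\ t|_n=u|_n\}$. *Lifting.* For a preordered set $(X,\le)$, $p:X\times X\to[0,1]$ and $A,B\subseteq X$ let $$H^*_p(A,B)=\max\Big\{\sup_{a\in A}\ \inf_{a'\in A,\,a'\ge a,\,b\in B}p(a',b),\ \ \sup_{b\in B}\ \inf_{b'\in B,\,b'\ge b,\,a\in A}p(a,b')\Big\}.$$ $H^*_r$ is formed with the order $\preceq$ on $\Lambda^r$; it is restricted to $\mathrm{Ide}(\Lambda^r)$, and $H^*_{H^*_r}$ is formed with the inclusion order on $\mathrm{Ide}(\Lambda^r)$. *Taylor expansion.* $\mathcal T(\bot)=\emptyset$, $\mathcal T(x)=\{x\}$, $\mathcal T(\lambda x.M)=\{\lambda x.t\mid t\in\mathcal T(M)\}$, $\mathcal T(MN)=\{t\langle t_1,\dots,t_n\rangle\mid t\in\mathcal T(M),\ n\in\mathbb N,\ t_1,\dots,t_n\in\mathcal T(N)\}$.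 For $\alpha\in\mathrm{Ide}(\mathcal A)$, $\mathcal T(\alpha)=\bigcup_{A\in\alpha}\mathcal T(A)$, and $\mathcal T^*(\alpha)=\mathrm{Ide}(\mathcal T(\alpha))$ is the set of ideals of $\Lambda^r$ contained in the lower set $\mathcal T(\alpha)$. **Theorem.** The map $\mathcal T^*:(\mathrm{Ide}(\mathcal A),p_{\mathrm{tree}})\to(\mathcal P(\mathrm{Ide}(\Lambda^r)),H^*_{H^*_r})$ preserves distances: for all $\alpha,\beta\in\mathrm{Ide}(\mathcal A)$ that are not both the empty tree $\{\bot\}$, $$H^*_{H^*_r}(\mathcal T^*(\alpha),\mathcal T^*(\beta))=p_{\mathrm{tree}}(\alpha,\beta).$$ -/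

import Mathlib

open unitInterval

noncomputable section

namespace BohmTaylor

/-! ### Partial terms and Böhm trees -/

/-- Partial `lambda`-terms: `lambda`-terms in de Bruijn notation enriched with a constant `bot`.
An index that points outside all enclosing abstractions is a free variable. -/
inductive Term : Type
  | bot : Term
  | var : ℕ → Term
  | lam : Term → Term
  | app : Term → Term → Term

namespace Term

/-- Normal forms for `β` together with the rules `λ x. ⊥ → ⊥` and `⊥ M → ⊥`. -/
def IsNormal : Term → Prop
  | bot => True
  | var _ => True
  | lam M => M ≠ bot ∧ M.IsNormal
  | app M N => M ≠ bot ∧ (∀ P, M ≠ lam P) ∧ M.IsNormal ∧ N.IsNormal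

/-- The contextual closure of the relation `⊥ ≺ M`. -/
inductive Step : Term → Term → Prop
  | fill (M : Term) : Step bot M
  | lam {M M' : Term} : Step M M' → Step (lam M) (lam M')
  | appLeft {M M' : Term} (N : Term) : Step M M' → Step (app M N) (app M' N)
  | appRight (M : Term) {N N' : Term} : Step N N' → Step (app M N) (app M N')

/-- The height of a (normal) partial term as a tree: `⊥` is the empty tree, of height `0`, and
`λ x₁ … xₙ. y M₁ … Mₖ` has height `1 + max (height Mᵢ)` (so `1` if `k = 0`). -/
def height : Term → ℕ
  | bot => 0
  | var _ => 1
  | lam M => M.height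
  | app M N => max M.height (1 + N.height)

/-- Truncation of a (normal) partial term, as a tree, at height `n`: the truncation at height `0` is
the empty tree `⊥`, and the truncation of `λ x₁ … xₙ. y M₁ … Mₖ` at height `m + 1` is
`λ x₁ … xₙ. y M₁' … Mₖ'` where `Mᵢ'` is the truncation of `Mᵢ` at height `m`. -/
def trunc : ℕ → Term → Term
  | 0, _ => bot
  | _ + 1, bot => bot
  | _ + 1, var i => var i
  | n + 1, lam M => lam (trunc (n + 1) M)
  | n + 1, app M N => app (trunc (n + 1) M) (trunc n N)

theorem trunc_succ_ne_bot (n : ℕ) (M : Term) (h : M ≠ bot) : trunc (n + 1) M ≠ bot := by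
  cases M <;> simp_all [trunc]

theorem trunc_succ_ne_lam (n : ℕ) (M : Term) (h : ∀ P, M ≠ lam P) (P : Term) :
    trunc (n + 1) M ≠ lam P := by
  cases M <;> simp_all [trunc]

theorem isNormal_trunc (n : ℕ) (M : Term) (h : M.IsNormal) : (trunc n M).IsNormal := by
  induction M generalizing n with
  | bot => cases n <;> trivial
  | var i => cases n <;> trivial
  | lam M ih =>
    cases n with
    | zero => trivial
    | succ n => exact ⟨trunc_succ_ne_bot n M h.1, ih _ h.2⟩
  | app M N ihM ihN =>
    cases n with
    | zero => trivial
    | succ n =>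
      exact ⟨trunc_succ_ne_bot n M h.1, trunc_succ_ne_lam n M h.2.1, ihM _ h.2.2.1, ihN _ h.2.2.2⟩

end Term

/-- The set of partial terms: the normal ones. They are the finite Böhm trees. -/
def PartialTerm : Type := {M : Term // M.IsNormal}

namespace PartialTerm

/-- The order on partial terms generated by replacing occurrences of `⊥`. -/
instance : Preorder PartialTerm where
  le A B := Relation.ReflTransGen Term.Step A.1 B.1
  le_refl _ := Relation.ReflTransGen.refl
  le_trans _ _ _ h h' := h.trans h'

instance : OrderBot PartialTerm where
  bot := ⟨Term.bot, trivial⟩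
  bot_le A := Relation.ReflTransGen.single (Term.Step.fill A.1)

def height (A : PartialTerm) : ℕ := A.1.height

def trunc (n : ℕ) (A : PartialTerm) : PartialTerm := ⟨A.1.trunc n, A.1.isNormal_trunc n A.2⟩

end PartialTerm

/-- Böhm trees, identified with the ideals (nonempty directed lower sets) of partial terms: a tree
is identified with the set of its finite approximants. The empty tree is the ideal `{⊥}`. -/
abbrev BohmTree : Type := Order.Ideal PartialTerm

namespace BohmTree

/-- The height of a Böhm tree. -/
def height (α : BohmTree) : ℕ∞ := ⨆ A ∈ α, (A.height : ℕ∞)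

/-- The truncation of a Böhm tree at height `n`, given by its set of finite approximants. -/
def trunc (n : ℕ) (α : BohmTree) : Set PartialTerm := PartialTerm.trunc n '' (α : Set PartialTerm)

/-- The truncations of `α` and `β` at height `n` are both defined and are equal. -/
def TruncEq (n : ℕ) (α β : BohmTree) : Prop :=
  (n : ℕ∞) ≤ height α ∧ (n : ℕ∞) ≤ height β ∧ trunc n α = trunc n β

/-- The height at which two trees diverge. -/
def div (α β : BohmTree) : ℕ∞ :=
  ⨅ n ∈ {n : ℕ | TruncEq n α β ∧ ¬ TruncEq (n + 1) α β}, (n : ℕ∞)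

end BohmTree

/-- `2 ^ (-n)` in the unit interval. -/
def twoPowNeg (n : ℕ) : I :=
  ⟨(2 : ℝ)⁻¹ ^ n, by positivity, pow_le_one₀ (by norm_num) (by norm_num)⟩

/-- `2 ^ (-n)` in the unit interval, for `n` possibly infinite, where `2 ^ (-∞) = 0`. -/
def twoPowNegInf : ℕ∞ → I
  | ⊤ => 0
  | (n : ℕ) => twoPowNeg n

/-- The tree partial metric. -/
def treeDist (α β : BohmTree) : I := twoPowNegInf (BohmTree.div α β)

/-! ### Resource terms -/

/-- Resource terms in de Bruijn notation with bags represented by lists. -/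
inductive RawRes : Type
  | var : ℕ → RawRes
  | lam : RawRes → RawRes
  | app : RawRes → List RawRes → RawRes

namespace RawRes

/-- The least congruence that identifies bags up to permutation. -/
inductive Equiv : RawRes → RawRes → Prop
  | refl (t : RawRes) : Equiv t t
  | symm {t u : RawRes} : Equiv t u → Equiv u t
  | trans {t u v : RawRes} : Equiv t u → Equiv u v → Equiv t v
  | lam {t u : RawRes} : Equiv t u → Equiv (lam t) (lam u)
  | appLeft {t u : RawRes} (l : List RawRes) : Equiv t u → Equiv (app t l) (app u l)
  | perm (t : RawRes) {l l' : List RawRes} : l.Perm l' → Equiv (app t l) (app t l')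
  | elem (t : RawRes) {u u' : RawRes} (l : List RawRes) :
      Equiv u u' → Equiv (app t (u :: l)) (app t (u' :: l))

instance setoid : Setoid RawRes := ⟨Equiv, ⟨Equiv.refl, Equiv.symm, Equiv.trans⟩⟩

theorem Equiv.bag_append (t : RawRes) {l l' : List RawRes} (h : List.Forall₂ Equiv l l')
    (m : List RawRes) : Equiv (app t (l ++ m)) (app t (l' ++ m)) := by
  induction h generalizing m with
  | nil => exact Equiv.refl _
  | @cons a b l l' hab _ ih =>
    refine (Equiv.elem t (l ++ m) hab).trans ?_
    refine (Equiv.perm t (List.perm_middle (l₁ := l) (a := b) (l₂ := m)).symm).trans ?_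
    exact (ih (b :: m)).trans (Equiv.perm t List.perm_middle)

theorem Equiv.bag (t : RawRes) {l l' : List RawRes} (h : List.Forall₂ Equiv l l') :
    Equiv (app t l) (app t l') := by
  simpa using Equiv.bag_append t h []

/-- See `ResTerm.height`. -/
def height : RawRes → ℕ
  | var _ => 1
  | lam t => t.height
  | app t l => max t.height (1 + (l.attach.map fun u => height u.1).foldr max 0)
decreasing_by
  all_goals simp_wf
  all_goals first
    | (have := List.sizeOf_lt_of_mem u.2; omega)
    | omega

/-- See `ResTerm.trunc`. -/
def trunc (n : ℕ) : RawRes → RawRes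
  | var i => var i
  | lam t => lam (trunc n t)
  | app t l => app (trunc n t) (if n ≤ 1 then [] else l.attach.map fun u => trunc (n - 1) u.1)
termination_by t => sizeOf t
decreasing_by
  all_goals simp_wf
  all_goals first
    | (have := List.sizeOf_lt_of_mem u.2; omega)
    | omega

theorem height_app (t : RawRes) (l : List RawRes) :
    (app t l).height = max t.height (1 + (l.map height).foldr max 0) := by
  rw [height, List.attach_map_val (f := height)]

theorem trunc_app (n : ℕ) (t : RawRes) (l : List RawRes) :
    trunc n (app t l) = app (trunc n t) (if n ≤ 1 then [] else l.map (trunc (n - 1))) := by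
  rw [trunc, List.attach_map_val (f := trunc (n - 1))]

theorem height_congr {t u : RawRes} (h : Equiv t u) : t.height = u.height := by
  induction h with
  | refl => rfl
  | symm _ ih => exact ih.symm
  | trans _ _ ih ih' => exact ih.trans ih'
  | lam _ ih => simpa [height] using ih
  | appLeft l _ ih => rw [height_app, height_app, ih]
  | perm t h => rw [height_app, height_app, (h.map height).foldr_op_eq]
  | elem t l _ ih => rw [height_app, height_app, List.map_cons, List.map_cons, ih]

theorem trunc_congr {t u : RawRes} (h : Equiv t u) (n : ℕ) : Equiv (trunc n t) (trunc n u) := by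
  induction h generalizing n with
  | refl => exact Equiv.refl _
  | symm _ ih => exact (ih n).symm
  | trans _ _ ih ih' => exact (ih n).trans (ih' n)
  | lam _ ih => simpa [trunc] using Equiv.lam (ih n)
  | appLeft l _ ih => rw [trunc_app, trunc_app]; exact Equiv.appLeft _ (ih n)
  | perm t h =>
    rw [trunc_app, trunc_app]
    split
    · exact Equiv.refl _
    · exact Equiv.perm _ (h.map _)
  | elem t l _ ih =>
    rw [trunc_app, trunc_app]
    split
    · exact Equiv.refl _
    · exact Equiv.elem _ _ (ih _)

end RawRes

/-- Resource terms `t ::= x | λ x. t | t ⟨t, …, t⟩`, where `⟨t, …, t⟩` is a finite multiset. -/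
def ResTerm : Type := Quotient RawRes.setoid

namespace ResTerm

def mk (t : RawRes) : ResTerm := Quotient.mk RawRes.setoid t

/-- A chosen representative. -/
def out (t : ResTerm) : RawRes := Quotient.out t

theorem mk_out (t : ResTerm) : mk t.out = t := Quotient.out_eq t

theorem out_mk (t : RawRes) : RawRes.Equiv (mk t).out t := Quotient.mk_out t

def var (i : ℕ) : ResTerm := mk (RawRes.var i)

def lam (t : ResTerm) : ResTerm := mk (RawRes.lam t.out)

/-- Application of a resource term to a bag; see `mk_app`. -/
def app (t : ResTerm) (b : Multiset ResTerm) : ResTerm :=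
  mk (RawRes.app t.out (b.toList.map out))

theorem mk_lam (t : RawRes) : mk (RawRes.lam t) = lam (mk t) :=
  Quotient.sound (RawRes.Equiv.lam (out_mk t).symm)

theorem mk_app (t : RawRes) (l : List RawRes) :
    mk (RawRes.app t l) = app (mk t) (l.map mk : List ResTerm) := by
  refine Quotient.sound ?_
  have hp : ((l.map mk : List ResTerm) : Multiset ResTerm).toList.Perm (l.map mk) :=
    Multiset.coe_eq_coe.1 (Multiset.coe_toList _)
  have hf : List.Forall₂ RawRes.Equiv l ((l.map mk).map out) := by
    rw [List.map_map, List.forall₂_map_right_iff]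
    exact List.forall₂_same.2 fun u _ => (out_mk u).symm
  exact ((RawRes.Equiv.appLeft l ((out_mk t).symm)).trans
    (RawRes.Equiv.bag _ hf)).trans (RawRes.Equiv.perm _ (hp.map out).symm)

/-- The height of a resource term. On a normal term `λ x₁ … xₙ. x b₁ … bₘ` it is one plus the maximum
of the heights of the elements of the bags `bᵢ` (see `height_app`). -/
def height (t : ResTerm) : ℕ := Quotient.lift RawRes.height (fun _ _ h => RawRes.height_congr h) t

/-- The truncation of a resource term at height `n ≥ 1`. On a normal term it replaces every subterm
`x b₁ … bₘ` with `x` at height `n` by `x ∅ … ∅` (see `trunc_app`); in `x b₁ … bₘ` the occurrence `x`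
has height `1`, and heights increase by one on entering a bag. The value at `n = 0` plays no role. -/
def trunc (n : ℕ) (t : ResTerm) : ResTerm :=
  Quotient.map (RawRes.trunc n) (fun _ _ h => RawRes.trunc_congr h n) t

theorem height_var (i : ℕ) : (var i).height = 1 := by
  change (RawRes.var i).height = 1
  rw [RawRes.height]

theorem height_lam (t : ResTerm) : (lam t).height = t.height := by
  induction t using Quotient.inductionOn with
  | h t =>
    change (lam (mk t)).height = t.height
    rw [← mk_lam]
    change (RawRes.lam t).height = t.height
    rw [RawRes.height]

theorem exists_map_mk (b : Multiset ResTerm) :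
    ∃ l : List RawRes, b = (l.map mk : List ResTerm) := by
  refine ⟨b.toList.map out, ?_⟩
  have : mk ∘ out = id := funext mk_out
  rw [List.map_map, this, List.map_id, Multiset.coe_toList]

theorem height_app (t : ResTerm) (b : Multiset ResTerm) :
    (app t b).height = max t.height (1 + (b.map height).sup) := by
  obtain ⟨l, rfl⟩ := exists_map_mk b
  induction t using Quotient.inductionOn with
  | h t =>
    change (app (mk t) _).height = max t.height _
    rw [← mk_app]
    change (RawRes.app t l).height = _
    rw [RawRes.height_app, Multiset.map_coe, List.map_map]
    rfl

theorem trunc_var (n i : ℕ) : (var i).trunc n = var i := by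
  change mk ((RawRes.var i).trunc n) = _
  rw [RawRes.trunc]
  rfl

theorem trunc_lam (n : ℕ) (t : ResTerm) : (lam t).trunc n = lam (t.trunc n) := by
  induction t using Quotient.inductionOn with
  | h t =>
    change (lam (mk t)).trunc n = lam (mk (t.trunc n))
    rw [← mk_lam, ← mk_lam]
    change mk ((RawRes.lam t).trunc n) = _
    rw [RawRes.trunc]

theorem trunc_app (n : ℕ) (t : ResTerm) (b : Multiset ResTerm) :
    (app t b).trunc n = app (t.trunc n) (if n ≤ 1 then 0 else b.map (trunc (n - 1))) := by
  obtain ⟨l, rfl⟩ := exists_map_mk b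
  induction t using Quotient.inductionOn with
  | h t =>
    change (app (mk t) _).trunc n = app (mk (t.trunc n)) _
    rw [← mk_app]
    change mk ((RawRes.app t l).trunc n) = _
    rw [RawRes.trunc_app, mk_app]
    split
    · rfl
    · rw [Multiset.map_coe, List.map_map, List.map_map]
      rfl

/-- The contextual closure of the relation `∅ ≺ ⟨u₁, …, uₙ⟩` on bags. -/
inductive Step : ResTerm → ResTerm → Prop
  | fill (t : ResTerm) (b : Multiset ResTerm) : Step (app t 0) (app t b)
  | lam {t t' : ResTerm} : Step t t' → Step (lam t) (lam t')
  | appLeft {t t' : ResTerm} (b : Multiset ResTerm) : Step t t' → Step (app t b) (app t' b)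
  | appRight (t : ResTerm) {u u' : ResTerm} (b : Multiset ResTerm) :
      Step u u' → Step (app t (u ::ₘ b)) (app t (u' ::ₘ b))

/-- The order on resource terms generated by filling empty bags. -/
instance : Preorder ResTerm where
  le := Relation.ReflTransGen Step
  le_refl _ := Relation.ReflTransGen.refl
  le_trans _ _ _ h h' := h.trans h'

/-- The resource partial metric. The infimum is taken in `[0, 1]`, so the index `n = 0`
contributes nothing. -/
def dist (t u : ResTerm) : I :=
  ⨅ n ∈ {n : ℕ | n ≤ t.height ∧ n ≤ u.height ∧ t.trunc n = u.trunc n}, twoPowNeg n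

end ResTerm

/-! ### The lifting of a distance to sets -/

/-- The lifting `H*` of a distance `p` on an ordered set `X` to sets: each point may first be moved
upwards within its own set. Suprema and infima are taken in `[0, 1]`, so that the empty supremum is
`0` and the empty infimum is `1`. -/
def hausdorffStar {X : Type} [LE X] (p : X → X → I) (A B : Set X) : I :=
  max (⨆ a ∈ A, ⨅ a' ∈ {a' | a' ∈ A ∧ a ≤ a'}, ⨅ b ∈ B, p a' b)
    (⨆ b ∈ B, ⨅ b' ∈ {b' | b' ∈ B ∧ b ≤ b'}, ⨅ a ∈ A, p a b')

/-- The distance `H*` of the resource partial metric on ideals of resource terms. -/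
def idealDist (A B : Order.Ideal ResTerm) : I :=
  hausdorffStar ResTerm.dist (A : Set ResTerm) (B : Set ResTerm)

/-! ### The Taylor expansion -/

/-- The Taylor expansion of a partial term. -/
def Term.taylor : Term → Set ResTerm
  | .bot => ∅
  | .var i => {ResTerm.var i}
  | .lam M => {t | ∃ s ∈ M.taylor, t = ResTerm.lam s}
  | .app M N => {t | ∃ s ∈ M.taylor, ∃ b : Multiset ResTerm,
      (∀ u ∈ b, u ∈ N.taylor) ∧ t = ResTerm.app s b}

/-- The Taylor expansion of a Böhm tree. -/
def taylor (α : BohmTree) : Set ResTerm := {t | ∃ A ∈ α, t ∈ A.1.taylor}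

/-- The set of ideals of the Taylor expansion of a Böhm tree (which is a lower set of resource
terms, so that its ideals are ideals of resource terms). -/
def taylorStar (α : BohmTree) : Set (Order.Ideal ResTerm) :=
  {J | (J : Set ResTerm) ⊆ taylor α}

end BohmTaylor

end

/-! Both inequalities compare `H` of the ideals of the two expansions with agreement of the trees at
a finite height.

Upper bound: if both trees reach height `n ≥ 1` and agree there, every ideal `J` of the expansion of
`α` extends to one at distance at most `2⁻ⁿ` from an ideal of the expansion of `β`. Moving up inside
`J` can change the truncation at `n` only finitely often (`ResTerm.exists_trunc_eq_of_le`), so some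
`a` has the same truncation as everything above it. If `a` is too short, it is the greatest element
of `J`, and `J` is enlarged to the principal ideal of a taller term (`exists_stable_ideal`). The
ideal generated by `a|ₙ` is then close, and lies in the expansion of `β` because the trees agree up
to `n` (`exists_idealDist_le`).

Lower bound: if `H < 2⁻ⁿ`, each `t` in one expansion lies below some `a` of that expansion which
agrees up to height `n + 1` with some `b` of the other. Applied to the single resource term that
determines `A|ₙ₊₁` from below (`Term.exists_mem_taylor_forall_le`), this puts `A|ₙ₊₁` into the other
tree, so the trees agree at `n + 1` (`truncEq_of_hausdorffStar_lt`). Only here must one tree be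
nonempty, to supply a `t` witnessing the heights. -/

namespace BohmTaylor

/-! ### Constructors of resource terms -/

namespace RawRes

/-- The outermost constructor of a resource term, with its arguments. -/
def view : RawRes → ℕ ⊕ ResTerm ⊕ (ResTerm × Multiset ResTerm)
  | var i => .inl i
  | lam t => .inr (.inl (ResTerm.mk t))
  | app t l => .inr (.inr (ResTerm.mk t, (l.map ResTerm.mk : List ResTerm)))

theorem view_congr {t u : RawRes} (h : Equiv t u) : t.view = u.view := by
  induction h with
  | refl => rfl
  | symm _ ih => exact ih.symm
  | trans _ _ ih ih' => exact ih.trans ih'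
  | lam h _ => simp only [view, show ResTerm.mk _ = ResTerm.mk _ from Quotient.sound h]
  | appLeft l h _ => simp only [view, show ResTerm.mk _ = ResTerm.mk _ from Quotient.sound h]
  | perm t h => simp only [view, Multiset.coe_eq_coe.2 (h.map ResTerm.mk)]
  | elem t l h _ =>
    simp only [view, List.map_cons, show ResTerm.mk _ = ResTerm.mk _ from Quotient.sound h]

/-- The number of empty bags at depth `d`. -/
def emptyBags (d : ℕ) : RawRes → ℕ
  | var _ => 0
  | lam t => emptyBags d t
  | app t l => emptyBags d t + if d = 0 then (if l.length = 0 then 1 else 0)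
      else (l.attach.map fun u => emptyBags (d - 1) u.1).sum
termination_by t => sizeOf t
decreasing_by
  all_goals simp_wf
  all_goals first
    | (have := List.sizeOf_lt_of_mem u.2; omega)
    | omega

theorem emptyBags_app (d : ℕ) (t : RawRes) (l : List RawRes) :
    emptyBags d (app t l) = emptyBags d t + if d = 0 then (if l.length = 0 then 1 else 0)
      else (l.map (emptyBags (d - 1))).sum := by
  rw [emptyBags, List.attach_map_val (f := emptyBags (d - 1))]

theorem emptyBags_congr {t u : RawRes} (h : Equiv t u) (d : ℕ) :
    emptyBags d t = emptyBags d u := by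
  induction h generalizing d with
  | refl => rfl
  | symm _ ih => exact (ih d).symm
  | trans _ _ ih ih' => exact (ih d).trans (ih' d)
  | lam _ ih => simpa only [emptyBags] using ih d
  | appLeft l _ ih => rw [emptyBags_app, emptyBags_app, ih]
  | perm t h => rw [emptyBags_app, emptyBags_app, (h.map _).sum_eq, h.length_eq]
  | elem t l _ ih =>
    rw [emptyBags_app, emptyBags_app, List.map_cons, List.map_cons, List.sum_cons, List.sum_cons,
      ih, List.length_cons, List.length_cons]

end RawRes

namespace ResTerm

/-- The outermost constructor of a resource term, with its arguments. -/
def view (t : ResTerm) : ℕ ⊕ ResTerm ⊕ (ResTerm × Multiset ResTerm) :=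
  Quotient.lift RawRes.view (fun _ _ h => RawRes.view_congr h) t

theorem view_var (i : ℕ) : (var i).view = .inl i := rfl

theorem view_lam (t : ResTerm) : (lam t).view = .inr (.inl t) := by
  change Sum.inr (Sum.inl (mk t.out)) = _
  rw [mk_out]

theorem view_app (t : ResTerm) (b : Multiset ResTerm) : (app t b).view = .inr (.inr (t, b)) := by
  change Sum.inr (Sum.inr (mk t.out, (((b.toList.map out).map mk : List ResTerm) :
    Multiset ResTerm))) = _
  have : mk ∘ out = id := funext mk_out
  rw [mk_out, List.map_map, this, List.map_id, Multiset.coe_toList]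

/-- The constructors are built on the quotient from chosen representatives, so injectivity and
disjointness are not automatic; `view` recovers the constructor and its arguments. -/
theorem var_inj {i j : ℕ} : var i = var j ↔ i = j :=
  ⟨fun h => by simpa [view_var] using congrArg view h, fun h => h ▸ rfl⟩

theorem lam_inj {t u : ResTerm} : lam t = lam u ↔ t = u :=
  ⟨fun h => by simpa [view_lam] using congrArg view h, fun h => h ▸ rfl⟩

theorem app_inj {t u : ResTerm} {b c : Multiset ResTerm} :
    app t b = app u c ↔ t = u ∧ b = c :=
  ⟨fun h => by simpa [view_app] using congrArg view h, fun h => h.1 ▸ h.2 ▸ rfl⟩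

theorem lam_ne_var (t : ResTerm) (i : ℕ) : lam t ≠ var i :=
  fun h => by simpa [view_var, view_lam] using congrArg view h

theorem app_ne_var (t : ResTerm) (b : Multiset ResTerm) (i : ℕ) : app t b ≠ var i :=
  fun h => by simpa [view_var, view_app] using congrArg view h

theorem app_ne_lam (t : ResTerm) (b : Multiset ResTerm) (u : ResTerm) : app t b ≠ lam u :=
  fun h => by simpa [view_lam, view_app] using congrArg view h

/-- Structural induction on resource terms. -/
theorem induction_on {P : ResTerm → Prop} (t : ResTerm) (var : ∀ i, P (var i))
    (lam : ∀ t, P t → P (lam t)) (app : ∀ t b, P t → (∀ u ∈ b, P u) → P (app t b)) : P t := by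
  induction t using Quotient.inductionOn with
  | h t =>
    change P (mk t)
    induction t using RawRes.rec (motive_2 := fun l => ∀ u ∈ l, P (mk u)) with
    | var i => exact var i
    | lam t ih => rw [mk_lam]; exact lam _ ih
    | app t l ih ihl =>
      rw [mk_app]
      refine app _ _ ih fun u hu => ?_
      obtain ⟨v, hv, rfl⟩ := List.mem_map.1 (Multiset.mem_coe.1 hu)
      exact ihl v hv
    | nil v hv => exact absurd hv List.not_mem_nil
    | cons u l ihu ihl v hv =>
      rcases List.mem_cons.1 hv with rfl | hv
      · exact ihu
      · exact ihl v hv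

/-- The number of empty bags at depth `d`. -/
def emptyBags (d : ℕ) (t : ResTerm) : ℕ :=
  Quotient.lift (RawRes.emptyBags d) (fun _ _ h => RawRes.emptyBags_congr h d) t

theorem emptyBags_lam (d : ℕ) (t : ResTerm) : (lam t).emptyBags d = t.emptyBags d := by
  induction t using Quotient.inductionOn with
  | h t =>
    change (lam (mk t)).emptyBags d = t.emptyBags d
    rw [← mk_lam]
    change (RawRes.lam t).emptyBags d = t.emptyBags d
    rw [RawRes.emptyBags]

theorem emptyBags_app (d : ℕ) (t : ResTerm) (b : Multiset ResTerm) :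
    (app t b).emptyBags d = t.emptyBags d + if d = 0 then (if b.card = 0 then 1 else 0)
      else (b.map (emptyBags (d - 1))).sum := by
  obtain ⟨l, rfl⟩ := exists_map_mk b
  induction t using Quotient.inductionOn with
  | h t =>
    change (app (mk t) _).emptyBags d = t.emptyBags d + _
    rw [← mk_app]
    change (RawRes.app t l).emptyBags d = _
    rw [RawRes.emptyBags_app, Multiset.map_coe, List.map_map, Multiset.sum_coe,
      Multiset.coe_card, List.length_map]
    rfl

/-! ### Order, height and truncation of resource terms -/

theorem Step.le {t u : ResTerm} (h : Step t u) : t ≤ u := Relation.ReflTransGen.single h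

theorem lam_mono {t u : ResTerm} (h : t ≤ u) : lam t ≤ lam u :=
  Relation.ReflTransGen.lift lam (fun _ _ => Step.lam) _ _ h

theorem app_mono_left {t u : ResTerm} (b : Multiset ResTerm) (h : t ≤ u) : app t b ≤ app u b :=
  Relation.ReflTransGen.lift (app · b) (fun _ _ => Step.appLeft b) _ _ h

theorem app_cons_mono (t : ResTerm) {u v : ResTerm} (b : Multiset ResTerm) (h : u ≤ v) :
    app t (u ::ₘ b) ≤ app t (v ::ₘ b) :=
  Relation.ReflTransGen.lift (fun u => app t (u ::ₘ b)) (fun _ _ => Step.appRight t b) _ _ h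

/-- The order raises one bag element at a time; `c` collects the elements already raised. -/
theorem app_map_le (t : ResTerm) (f : ResTerm → ResTerm) (b c : Multiset ResTerm)
    (h : ∀ u ∈ b, f u ≤ u) : app t (b.map f + c) ≤ app t (b + c) := by
  induction b using Multiset.induction generalizing c with
  | empty => simp
  | cons u b ih =>
    rw [Multiset.map_cons, Multiset.cons_add, Multiset.cons_add]
    refine (app_cons_mono t _ (h u (Multiset.mem_cons_self u b))).trans ?_
    have := ih (u ::ₘ c) fun v hv => h v (Multiset.mem_cons_of_mem hv)
    rwa [Multiset.add_cons, Multiset.add_cons] at this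

theorem trunc_le (n : ℕ) (t : ResTerm) : t.trunc n ≤ t := by
  induction t using induction_on generalizing n with
  | var i => rw [trunc_var]
  | lam t ih => rw [trunc_lam]; exact lam_mono (ih n)
  | app t b iht ihb =>
    rw [trunc_app]
    refine (app_mono_left _ (iht n)).trans ?_
    split
    · exact (Step.fill t b).le
    · simpa using app_map_le t (trunc (n - 1)) b 0 fun u hu => ihb u hu _

theorem Step.trunc_le_trunc {t u : ResTerm} (h : Step t u) (n : ℕ) : t.trunc n ≤ u.trunc n := by
  induction h generalizing n with
  | fill t b =>
    rw [trunc_app, trunc_app]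
    simpa using (Step.fill _ _).le
  | lam _ ih => rw [trunc_lam, trunc_lam]; exact lam_mono (ih n)
  | appLeft b _ ih => rw [trunc_app, trunc_app]; exact app_mono_left _ (ih n)
  | appRight t b _ ih =>
    rw [trunc_app, trunc_app]
    split
    · exact le_rfl
    · rw [Multiset.map_cons, Multiset.map_cons]
      exact app_cons_mono _ _ (ih _)

theorem trunc_mono (n : ℕ) {t u : ResTerm} (h : t ≤ u) : t.trunc n ≤ u.trunc n := by
  induction h with
  | refl => exact le_rfl
  | tail _ h ih => exact ih.trans (h.trunc_le_trunc n)

theorem trunc_trunc {m n : ℕ} (h : m ≤ n) (t : ResTerm) : (t.trunc n).trunc m = t.trunc m := by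
  induction t using induction_on generalizing m n with
  | var i => rw [trunc_var]
  | lam t ih => simp only [trunc_lam, ih h]
  | app t b iht ihb =>
    simp only [trunc_app, iht h]
    by_cases hm : m ≤ 1
    · simp [hm]
    · rw [if_neg hm, if_neg hm, if_neg (by omega), Multiset.map_map]
      congr 1
      exact Multiset.map_congr rfl fun u hu => ihb u hu (by omega)

theorem one_le_height (t : ResTerm) : 1 ≤ t.height := by
  induction t using induction_on with
  | var i => rw [height_var]
  | lam t ih => rwa [height_lam]
  | app t b ih _ => rw [height_app]; exact ih.trans (le_max_left _ _)

theorem height_le_sup {b : Multiset ResTerm} {u : ResTerm} (hu : u ∈ b) :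
    u.height ≤ (b.map height).sup :=
  Multiset.le_sup (Multiset.mem_map_of_mem _ hu)

theorem exists_le_height_of_le_sup {b : Multiset ResTerm} {n : ℕ} (hn : n ≠ 0)
    (h : n ≤ (b.map height).sup) : ∃ u ∈ b, n ≤ u.height := by
  by_contra! H
  have : (b.map height).sup ≤ n - 1 := by
    refine Multiset.sup_le.2 fun k hk => ?_
    obtain ⟨u, hu, rfl⟩ := Multiset.mem_map.1 hk
    have := H u hu
    omega
  omega

theorem trunc_eq_self {n : ℕ} {t : ResTerm} (h : t.height ≤ n) : t.trunc n = t := by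
  induction t using induction_on generalizing n with
  | var i => rw [trunc_var]
  | lam t ih => rw [trunc_lam, ih (by rwa [height_lam] at h)]
  | app t b iht ihb =>
    rw [height_app, max_le_iff] at h
    have hb : ∀ u ∈ b, u.height ≤ n - 1 := fun u hu => by
      have := height_le_sup hu
      omega
    rw [trunc_app, iht h.1]
    congr 1
    -- For `n ≤ 1` truncation empties the bag, but the bag was already empty: its elements would
    -- have height `0`.
    split
    · refine (Multiset.eq_zero_of_forall_notMem fun u hu => ?_).symm
      have := hb u hu
      have := one_le_height u
      omega
    · exact (Multiset.map_congr rfl fun u hu => ihb u hu (hb u hu)).trans (Multiset.map_id' b)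

theorem le_height_trunc {n : ℕ} {t : ResTerm} (h : n ≤ t.height) : n ≤ (t.trunc n).height := by
  induction t using induction_on generalizing n with
  | var i => rwa [trunc_var]
  | lam t ih => rw [height_lam] at h; rw [trunc_lam, height_lam]; exact ih h
  | app t b iht ihb =>
    -- Truncation at `n ≤ 1` discards all bags; every height is at least `1` anyway.
    rcases Nat.lt_or_ge 1 n with hn | hn
    swap
    · exact hn.trans (one_le_height _)
    rw [height_app, le_max_iff] at h
    rw [trunc_app, height_app, le_max_iff]
    refine h.imp iht fun h => ?_
    rw [if_neg (by omega)]
    obtain ⟨u, hu, h'⟩ := exists_le_height_of_le_sup (b := b) (n := n - 1) (by omega) (by omega)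
    have := ihb u hu h'
    have := height_le_sup (Multiset.mem_map_of_mem (trunc (n - 1)) hu)
    omega

/-! ### The ascending chain condition for truncated resource terms -/

/-- The numbers of empty bags at depths less than `n`, to be compared lexicographically. -/
def emptyBagsLex (n : ℕ) (t : ResTerm) : Lex (Fin n → ℕ) := toLex fun d => t.emptyBags d

/-- Filling an empty bag at depth `d` with something nonempty removes one empty bag at depth `d` and
creates new ones only deeper, so the counts drop lexicographically. Truncation at `n + 1` empties
all bags at depth at least `n`, so filling there is invisible to it. -/
theorem Step.trunc_eq_or_emptyBags_lt {t u : ResTerm} (h : Step t u) (n : ℕ) :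
    (t.trunc (n + 1) = u.trunc (n + 1) ∧ ∀ d < n, t.emptyBags d = u.emptyBags d) ∨
      ∃ d < n, u.emptyBags d < t.emptyBags d ∧ ∀ e < d, t.emptyBags e = u.emptyBags e := by
  induction h generalizing n with
  | fill t b =>
    rcases Multiset.empty_or_exists_mem b with rfl | ⟨v, hv⟩
    · exact .inl ⟨rfl, fun _ _ => rfl⟩
    · rcases n with _ | n
      · exact .inl ⟨by simp [trunc_app], by simp⟩
      · refine .inr ⟨0, n.succ_pos, ?_, by simp⟩
        have : b ≠ 0 := by rintro rfl; simp at hv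
        simp [emptyBags_app, this]
  | lam _ ih => simpa only [trunc_lam, emptyBags_lam, lam_inj] using ih n
  | appLeft b _ ih =>
    simpa only [trunc_app, emptyBags_app, app_inj, and_true, add_left_inj, add_lt_add_iff_right]
      using ih n
  | appRight t b _ ih =>
    rcases n with _ | n
    · exact .inl ⟨by simp [trunc_app], by simp⟩
    · rcases ih n with ⟨h, h'⟩ | ⟨d, hd, h, h'⟩
      · refine .inl ⟨by simp [trunc_app, h], ?_⟩
        rintro (_ | d) hd
        · simp [emptyBags_app]
        · simp [emptyBags_app, h' d (by omega)]
      · refine .inr ⟨d + 1, by omega, by simpa [emptyBags_app] using h, ?_⟩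
        rintro (_ | e) he
        · simp [emptyBags_app]
        · simp [emptyBags_app, h' e (by omega)]

theorem trunc_eq_or_emptyBagsLex_lt (n : ℕ) {t u : ResTerm} (h : t ≤ u) :
    (t.trunc (n + 1) = u.trunc (n + 1) ∧ t.emptyBagsLex n = u.emptyBagsLex n) ∨
      u.emptyBagsLex n < t.emptyBagsLex n := by
  induction h with
  | refl => exact .inl ⟨rfl, rfl⟩
  | tail _ h ih =>
    have key : _ ∨ _ := h.trunc_eq_or_emptyBags_lt n
    rcases key with ⟨h₁, h₂⟩ | ⟨d, hd, h₁, h₂⟩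
    · have h₂ := congrArg toLex (funext fun d : Fin n => h₂ d d.2)
      rcases ih with ⟨h₃, h₄⟩ | h₃
      · exact .inl ⟨h₃.trans h₁, h₄.trans h₂⟩
      · exact .inr (lt_of_eq_of_lt h₂.symm h₃)
    · have : emptyBagsLex n _ < emptyBagsLex n _ :=
        ⟨⟨d, hd⟩, fun e he => (h₂ e he).symm, h₁⟩
      rcases ih with ⟨h₃, h₄⟩ | h₃
      · exact .inr (h₄ ▸ this)
      · exact .inr (this.trans h₃)

theorem trunc_eq_of_le_of_le (n : ℕ) {t u : ResTerm} (h : t ≤ u) (h' : u ≤ t) :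
    t.trunc (n + 1) = u.trunc (n + 1) := by
  rcases trunc_eq_or_emptyBagsLex_lt n h with h₁ | h₁
  · exact h₁.1
  rcases trunc_eq_or_emptyBagsLex_lt n h' with h₂ | h₂
  · exact h₂.1.symm
  · exact absurd h₁ h₂.asymm

/-- In a nonempty set of resource terms, some element has the same truncation as all its upper
bounds. -/
theorem exists_trunc_eq_of_le (n : ℕ) {S : Set ResTerm} (hS : S.Nonempty) :
    ∃ a ∈ S, ∀ b ∈ S, a ≤ b → b.trunc (n + 1) = a.trunc (n + 1) := by
  -- Any upper bound with a different truncation would have a smaller measure.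
  obtain ⟨_, ⟨a, ha, rfl⟩, hmin⟩ :=
    WellFounded.has_min (wellFounded_lt (α := Lex (Fin n → ℕ))) _ (hS.image (emptyBagsLex n))
  refine ⟨a, ha, fun b hb hab => ?_⟩
  rcases trunc_eq_or_emptyBagsLex_lt n hab with h | h
  · exact h.1.symm
  · exact absurd h (hmin _ ⟨b, hb, rfl⟩)

end ResTerm

/-! ### Order, height and truncation of partial terms -/

namespace Term

theorem lam_mono {M N : Term} (h : Relation.ReflTransGen Step M N) :
    Relation.ReflTransGen Step (lam M) (lam N) :=
  Relation.ReflTransGen.lift lam (fun _ _ => Step.lam) _ _ h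

theorem app_mono {M M' N N' : Term} (h : Relation.ReflTransGen Step M M')
    (h' : Relation.ReflTransGen Step N N') : Relation.ReflTransGen Step (app M N) (app M' N') :=
  (Relation.ReflTransGen.lift (app · N) (fun _ _ => Step.appLeft N) _ _ h).trans
    (Relation.ReflTransGen.lift (app M') (fun _ _ => Step.appRight M') _ _ h')

theorem trunc_le (n : ℕ) (M : Term) : Relation.ReflTransGen Step (trunc n M) M := by
  induction M generalizing n with
  | bot => cases n <;> exact .refl
  | var i =>
    cases n
    · exact .single (.fill _)
    · exact .refl
  | lam M ih =>
    cases n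
    · exact .single (.fill _)
    · exact lam_mono (ih _)
  | app M N ihM ihN =>
    cases n
    · exact .single (.fill _)
    · exact app_mono (ihM _) (ihN _)

theorem trunc_trunc (n : ℕ) (M : Term) : trunc n (trunc n M) = trunc n M := by
  induction M generalizing n with
  | lam M ih => cases n <;> simp [trunc, ih]
  | app M N ihM ihN => cases n <;> simp [trunc, ihM, ihN]
  | _ => cases n <;> simp [trunc]

theorem height_trunc_le (n : ℕ) (M : Term) : (trunc n M).height ≤ n := by
  induction M generalizing n with
  | lam M ih =>
    cases n
    · simp [trunc, height]
    · simpa [trunc, height] using ih _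
  | app M N ihM ihN =>
    cases n with
    | zero => simp [trunc, height]
    | succ n =>
      have := ihM (n + 1)
      have := ihN n
      simp only [trunc, height]
      omega
  | _ => cases n <;> simp [trunc, height]

theorem Step.height_le {M N : Term} (h : Step M N) : M.height ≤ N.height := by
  induction h with
  | fill M => exact Nat.zero_le _
  | _ => simp only [height]; omega

theorem height_mono {M N : Term} (h : Relation.ReflTransGen Step M N) : M.height ≤ N.height := by
  induction h with
  | refl => exact le_rfl
  | tail _ h ih => exact ih.trans h.height_le

/-! ### The Taylor expansion of a term -/

theorem var_mem_taylor {i : ℕ} {M : Term} : ResTerm.var i ∈ M.taylor ↔ M = var i := by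
  cases M with
  | bot => simp [taylor]
  | var j => simp [taylor, ResTerm.var_inj, eq_comm]
  | lam M => simp [taylor, (ResTerm.lam_ne_var _ _).symm]
  | app M N => simp [taylor, (ResTerm.app_ne_var _ _ _).symm]

theorem lam_mem_taylor {t : ResTerm} {M : Term} :
    ResTerm.lam t ∈ M.taylor ↔ ∃ N, M = lam N ∧ t ∈ N.taylor := by
  cases M with
  | bot => simp [taylor]
  | var j => simp [taylor, ResTerm.lam_ne_var]
  | lam M => simp [taylor, ResTerm.lam_inj]
  | app M N => simp [taylor, (ResTerm.app_ne_lam _ _ _).symm]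

theorem app_mem_taylor {t : ResTerm} {b : Multiset ResTerm} {M : Term} :
    ResTerm.app t b ∈ M.taylor ↔
      ∃ N P, M = app N P ∧ t ∈ N.taylor ∧ ∀ u ∈ b, u ∈ P.taylor := by
  cases M with
  | bot => simp [taylor]
  | var j => simp [taylor, ResTerm.app_ne_var]
  | lam M => simp [taylor, ResTerm.app_ne_lam]
  | app M N =>
    constructor
    · rintro ⟨s, hs, c, hc, h⟩
      obtain ⟨rfl, rfl⟩ := ResTerm.app_inj.1 h
      exact ⟨M, N, rfl, hs, hc⟩
    · rintro ⟨_, _, h, hs, hc⟩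
      cases h
      exact ⟨t, hs, b, hc, rfl⟩

theorem lam_mem_taylor_lam {t : ResTerm} {M : Term} (h : t ∈ M.taylor) :
    ResTerm.lam t ∈ (lam M).taylor := ⟨t, h, rfl⟩

theorem app_mem_taylor_app {t : ResTerm} {b : Multiset ResTerm} {M N : Term} (h : t ∈ M.taylor)
    (hb : ∀ u ∈ b, u ∈ N.taylor) : ResTerm.app t b ∈ (app M N).taylor := ⟨t, h, b, hb, rfl⟩

theorem Step.taylor_subset {M N : Term} (h : Step M N) : M.taylor ⊆ N.taylor := by
  induction h with
  | fill M => exact Set.empty_subset _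
  | lam _ ih =>
    rintro _ ⟨t, ht, rfl⟩
    exact lam_mem_taylor_lam (ih ht)
  | appLeft N _ ih =>
    rintro _ ⟨t, ht, b, hb, rfl⟩
    exact app_mem_taylor_app (ih ht) hb
  | appRight M _ ih =>
    rintro _ ⟨t, ht, b, hb, rfl⟩
    exact app_mem_taylor_app ht fun u hu => ih (hb u hu)

theorem taylor_mono {M N : Term} (h : Relation.ReflTransGen Step M N) :
    M.taylor ⊆ N.taylor := by
  induction h with
  | refl => exact subset_rfl
  | tail _ h ih => exact ih.trans h.taylor_subset

theorem mem_taylor_of_step {t u : ResTerm} (h : ResTerm.Step t u) {M : Term}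
    (hu : u ∈ M.taylor) : t ∈ M.taylor := by
  induction h generalizing M with
  | fill t b =>
    obtain ⟨N, P, rfl, ht, -⟩ := app_mem_taylor.1 hu
    exact app_mem_taylor_app ht (by simp)
  | lam _ ih =>
    obtain ⟨N, rfl, ht⟩ := lam_mem_taylor.1 hu
    exact lam_mem_taylor_lam (ih ht)
  | appLeft b _ ih =>
    obtain ⟨N, P, rfl, ht, hb⟩ := app_mem_taylor.1 hu
    exact app_mem_taylor_app (ih ht) hb
  | appRight t b _ ih =>
    obtain ⟨N, P, rfl, ht, hb⟩ := app_mem_taylor.1 hu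
    rw [Multiset.forall_mem_cons] at hb
    exact app_mem_taylor_app ht (Multiset.forall_mem_cons.2 ⟨ih hb.1, hb.2⟩)

theorem isLowerSet_taylor (M : Term) : IsLowerSet M.taylor := by
  intro u t h hu
  induction h with
  | refl => exact hu
  | tail _ h ih => exact ih (mem_taylor_of_step h hu)

/-! ### Height and truncation in Taylor expansions -/

theorem height_le_of_mem_taylor {M : Term} {t : ResTerm} (h : t ∈ M.taylor) :
    t.height ≤ M.height := by
  induction M generalizing t with
  | bot => exact h.elim
  | var i =>
    obtain rfl : t = _ := h
    rw [ResTerm.height_var, height]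
  | lam M ih =>
    obtain ⟨s, hs, rfl⟩ := h
    rw [ResTerm.height_lam]
    exact ih hs
  | app M N ihM ihN =>
    obtain ⟨s, hs, b, hb, rfl⟩ := h
    rw [ResTerm.height_app, height]
    refine max_le_max (ihM hs) (Nat.add_le_add_left (Multiset.sup_le.2 fun k hk => ?_) 1)
    obtain ⟨u, hu, rfl⟩ := Multiset.mem_map.1 hk
    exact ihN (hb u hu)

/-- The index must be positive: truncating a partial term at `0` gives `⊥`, whose expansion is
empty. -/
theorem trunc_mem_taylor_trunc {M : Term} {t : ResTerm} (h : t ∈ M.taylor) (n : ℕ) :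
    t.trunc (n + 1) ∈ (M.trunc (n + 1)).taylor := by
  induction M generalizing t n with
  | bot => exact h.elim
  | var i =>
    obtain rfl : t = _ := h
    rw [ResTerm.trunc_var]
    rfl
  | lam M ih =>
    obtain ⟨s, hs, rfl⟩ := h
    rw [ResTerm.trunc_lam]
    exact lam_mem_taylor_lam (ih hs n)
  | app M N ihM ihN =>
    obtain ⟨s, hs, b, hb, rfl⟩ := h
    rw [ResTerm.trunc_app]
    refine app_mem_taylor_app (ihM hs n) ?_
    rcases n with _ | n
    · simp
    · rw [if_neg (by omega)]
      intro u hu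
      obtain ⟨v, hv, rfl⟩ := Multiset.mem_map.1 hu
      exact ihN (hb v hv) n

/-- A normal term other than `⊥` is determined from below by one element of its Taylor expansion,
which takes every argument other than `⊥` exactly once. -/
theorem exists_mem_taylor_forall_le {M : Term} (hM : M.IsNormal) (h : M ≠ bot) :
    ∃ t ∈ M.taylor, ∀ N : Term, t ∈ N.taylor → Relation.ReflTransGen Step M N := by
  induction M with
  | bot => exact absurd rfl h
  | var i => exact ⟨_, rfl, fun N hN => by rw [var_mem_taylor.1 hN]⟩
  | lam M ih =>
    obtain ⟨t, ht, hle⟩ := ih hM.2 hM.1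
    refine ⟨_, lam_mem_taylor_lam ht, fun N hN => ?_⟩
    obtain ⟨P, rfl, hP⟩ := lam_mem_taylor.1 hN
    exact lam_mono (hle P hP)
  | app M N ihM ihN =>
    obtain ⟨t, ht, hle⟩ := ihM hM.2.2.1 hM.1
    -- An argument `⊥` contributes the empty bag, which imposes no constraint, and none is needed
    -- since `⊥` is least. Any other argument contributes a singleton.
    obtain ⟨b, hb, hle'⟩ : ∃ b : Multiset ResTerm, (∀ u ∈ b, u ∈ N.taylor) ∧
        ∀ P : Term, (∀ u ∈ b, u ∈ P.taylor) → Relation.ReflTransGen Step N P := by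
      by_cases hN : N = bot
      · subst hN
        exact ⟨0, by simp, fun P _ => .single (.fill P)⟩
      · obtain ⟨u, hu, hle'⟩ := ihN hM.2.2.2 hN
        exact ⟨{u}, by simpa using hu, fun P hP => hle' P (hP u (by simp))⟩
    refine ⟨_, app_mem_taylor_app ht hb, fun P hP => ?_⟩
    obtain ⟨P, Q, rfl, hP, hQ⟩ := app_mem_taylor.1 hP
    exact app_mono (hle P hP) (hle' Q hQ)

theorem exists_mem_taylor {M : Term} (hM : M.IsNormal) (h : M ≠ bot) : ∃ t, t ∈ M.taylor :=
  let ⟨t, ht, _⟩ := exists_mem_taylor_forall_le hM h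
  ⟨t, ht⟩

/-- A resource term may miss the tall branches of `M` by leaving bags empty or their contents too
short. Filling each such bag, or raising one of its elements, recovers the full height. -/
theorem exists_ge_height_le {M : Term} (hM : M.IsNormal) {t : ResTerm} (h : t ∈ M.taylor) :
    ∃ u ∈ M.taylor, t ≤ u ∧ M.height ≤ u.height := by
  induction M generalizing t with
  | bot => exact h.elim
  | var i => exact ⟨t, h, le_rfl, t.one_le_height⟩
  | lam M ih =>
    obtain ⟨s, hs, rfl⟩ := h
    obtain ⟨u, hu, hle, hh⟩ := ih hM.2 hs
    exact ⟨_, lam_mem_taylor_lam hu, ResTerm.lam_mono hle, by rwa [ResTerm.height_lam]⟩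
  | app M N ihM ihN =>
    obtain ⟨s, hs, b, hb, rfl⟩ := h
    obtain ⟨u, hu, hle, hh⟩ := ihM hM.2.2.1 hs
    obtain ⟨c, hc, hle', hh'⟩ : ∃ c : Multiset ResTerm, (∀ v ∈ c, v ∈ N.taylor) ∧
        ResTerm.app u b ≤ ResTerm.app u c ∧ N.height ≤ (c.map ResTerm.height).sup := by
      by_cases hN : N = bot
      · subst hN
        exact ⟨b, hb, le_rfl, Nat.zero_le _⟩
      rcases Multiset.empty_or_exists_mem b with rfl | ⟨v, hv⟩
      · obtain ⟨v, hv⟩ := exists_mem_taylor hM.2.2.2 hN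
        obtain ⟨w, hw, -, hh'⟩ := ihN hM.2.2.2 hv
        exact ⟨{w}, by simpa using hw, (ResTerm.Step.fill _ _).le, by simpa using hh'⟩
      · obtain ⟨b, rfl⟩ := Multiset.exists_cons_of_mem hv
        rw [Multiset.forall_mem_cons] at hb
        obtain ⟨w, hw, hvw, hh'⟩ := ihN hM.2.2.2 hb.1
        exact ⟨w ::ₘ b, Multiset.forall_mem_cons.2 ⟨hw, hb.2⟩, ResTerm.app_cons_mono _ _ hvw,
          hh'.trans (ResTerm.height_le_sup (Multiset.mem_cons_self w b))⟩
    refine ⟨_, app_mem_taylor_app hu hc, (ResTerm.app_mono_left b hle).trans hle', ?_⟩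
    rw [ResTerm.height_app, height]
    omega

end Term

/-! ### Böhm trees and their Taylor expansions -/

namespace BohmTree

theorem exists_mem_ne_bot {α : BohmTree} (h : α ≠ ⊥) : ∃ A ∈ α, A.1 ≠ Term.bot := by
  by_contra! H
  refine h (le_bot_iff.1 fun A hA => ?_)
  obtain rfl : A = ⊥ := Subtype.ext (H A hA)
  exact (⊥ : BohmTree).bot_mem

theorem exists_le_height {α : BohmTree} {n : ℕ} (h : (n : ℕ∞) ≤ α.height) :
    ∃ A ∈ α, n ≤ A.height := by
  rcases Nat.eq_zero_or_pos n with rfl | hn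
  · exact ⟨⊥, α.bot_mem, Nat.zero_le _⟩
  -- A strict bound below the supremum yields a witness; `n - 1 < A.height` is then `n ≤ A.height`.
  have : ((n - 1 : ℕ) : ℕ∞) < ⨆ A ∈ α, (A.height : ℕ∞) :=
    lt_of_lt_of_le (by exact_mod_cast Nat.sub_lt hn one_pos) h
  simp only [lt_iSup_iff, Nat.cast_lt] at this
  obtain ⟨A, hA, h'⟩ := this
  exact ⟨A, hA, by omega⟩

theorem height_le {α : BohmTree} {A : PartialTerm} (h : A ∈ α) : (A.height : ℕ∞) ≤ α.height :=
  le_iSup₂ (f := fun (A : PartialTerm) (_ : A ∈ α) => (A.height : ℕ∞)) A h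

theorem TruncEq.symm {n : ℕ} {α β : BohmTree} (h : TruncEq n α β) : TruncEq n β α :=
  ⟨h.2.1, h.1, h.2.2.symm⟩

theorem truncEq_zero (α β : BohmTree) : TruncEq 0 α β := by
  have key (γ : BohmTree) : trunc 0 γ = {⊥} := by
    have : PartialTerm.trunc 0 = fun _ => ⊥ := by
      funext A
      exact Subtype.ext (by cases h : A.1 <;> simp [PartialTerm.trunc, Term.trunc, h] <;> rfl)
    rw [trunc, this, γ.nonempty.image_const]
  exact ⟨by simp, by simp, by rw [key, key]⟩

/-- Agreement holds at height `0`, and infinite divergence means that it never stops from one height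
to the next. -/
theorem truncEq_of_div_eq_top {α β : BohmTree} (h : div α β = ⊤) (n : ℕ) : TruncEq n α β := by
  induction n with
  | zero => exact truncEq_zero α β
  | succ n ih =>
    by_contra h'
    simp only [div, iInf_eq_top] at h
    exact ENat.natCast_ne_top n (h n ⟨ih, h'⟩)

/-- A finite infimum of natural numbers is attained: some `m < n + 1` is in the set, and `n ≤ m`. -/
theorem truncEq_of_div_eq_coe {α β : BohmTree} {n : ℕ} (h : div α β = n) :
    TruncEq n α β ∧ ¬ TruncEq (n + 1) α β := by
  have : div α β < (n + 1 : ℕ) := by rw [h]; exact_mod_cast n.lt_succ_self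
  simp only [div, iInf_lt_iff] at this
  obtain ⟨m, hm, hmn⟩ := this
  have hle : div α β ≤ m := iInf₂_le m hm
  rw [h, Nat.cast_le] at hle
  obtain rfl : m = n := le_antisymm (Nat.lt_succ_iff.1 (by exact_mod_cast hmn)) hle
  exact hm

theorem trunc_mem {α : BohmTree} {A : PartialTerm} (h : A ∈ α) (n : ℕ) :
    PartialTerm.trunc n A ∈ α :=
  α.lower (Term.trunc_le n A.1) h

end BohmTree

theorem isLowerSet_taylor (α : BohmTree) : IsLowerSet (taylor α) := by
  rintro t u h ⟨A, hA, ht⟩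
  exact ⟨A, hA, A.1.isLowerSet_taylor h ht⟩

theorem height_le_of_mem_taylor {α : BohmTree} {t : ResTerm} (h : t ∈ taylor α) :
    (t.height : ℕ∞) ≤ α.height := by
  obtain ⟨A, hA, ht⟩ := h
  exact le_trans (by exact_mod_cast Term.height_le_of_mem_taylor ht) (BohmTree.height_le hA)

theorem principal_mem_taylorStar {α : BohmTree} {t : ResTerm} (h : t ∈ taylor α) :
    Order.Ideal.principal t ∈ taylorStar α :=
  fun _ hu => isLowerSet_taylor α hu h

theorem exists_mem_taylor {α : BohmTree} (h : α ≠ ⊥) : ∃ t, t ∈ taylor α := by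
  obtain ⟨A, hA, hne⟩ := BohmTree.exists_mem_ne_bot h
  obtain ⟨t, ht⟩ := Term.exists_mem_taylor A.2 hne
  exact ⟨t, A, hA, ht⟩

/-- Directedness puts an approximant carrying `t` and an approximant of height at least `n` below a
common one, in whose expansion `t` can be raised. -/
theorem exists_ge_le_height {α : BohmTree} {n : ℕ} (hn : (n : ℕ∞) ≤ α.height) {t : ResTerm}
    (h : t ∈ taylor α) : ∃ u ∈ taylor α, t ≤ u ∧ n ≤ u.height := by
  obtain ⟨A, hA, ht⟩ := h
  obtain ⟨B, hB, hnB⟩ := BohmTree.exists_le_height hn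
  obtain ⟨C, hC, hAC, hBC⟩ := α.directed A hA B hB
  obtain ⟨u, hu, htu, hCu⟩ := Term.exists_ge_height_le C.2 (Term.taylor_mono hAC ht)
  exact ⟨u, ⟨C, hC, hu⟩, htu, hnB.trans ((Term.height_mono hBC).trans hCu)⟩

theorem trunc_mem_taylor {α β : BohmTree} {n : ℕ}
    (h : BohmTree.trunc (n + 1) α = BohmTree.trunc (n + 1) β) {t : ResTerm} (ht : t ∈ taylor α) :
    t.trunc (n + 1) ∈ taylor β := by
  obtain ⟨A, hA, ht⟩ := ht
  obtain ⟨B, hB, hBA⟩ : PartialTerm.trunc (n + 1) A ∈ BohmTree.trunc (n + 1) β :=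
    h ▸ Set.mem_image_of_mem _ hA
  have := Term.trunc_mem_taylor_trunc ht n
  rw [← show B.1.trunc (n + 1) = A.1.trunc (n + 1) from congrArg Subtype.val hBA] at this
  exact ⟨B, hB, Term.taylor_mono (Term.trunc_le _ _) this⟩

/-! ### Distances -/

theorem twoPowNeg_strictAnti : StrictAnti twoPowNeg := fun _ _ h =>
  Subtype.mk_lt_mk.2 (pow_lt_pow_right_of_lt_one₀ (by norm_num) (by norm_num) h)

theorem twoPowNeg_zero : twoPowNeg 0 = 1 := Subtype.ext (pow_zero _)

theorem eq_zero_of_forall_le_twoPowNeg {x : I} (h : ∀ n, x ≤ twoPowNeg n) : x = 0 := by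
  refine le_antisymm (Subtype.coe_le_coe.1 ?_) x.2.1
  have : Filter.Tendsto (fun n : ℕ => (2 : ℝ)⁻¹ ^ n) Filter.atTop (nhds 0) :=
    tendsto_pow_atTop_nhds_zero_of_lt_one (by norm_num) (by norm_num)
  exact ge_of_tendsto' this fun n => Subtype.coe_le_coe.2 (h n)

namespace ResTerm

theorem dist_comm (t u : ResTerm) : dist t u = dist u t := by
  unfold dist
  have (n : ℕ) : (n ≤ t.height ∧ n ≤ u.height ∧ t.trunc n = u.trunc n) ↔
      n ≤ u.height ∧ n ≤ t.height ∧ u.trunc n = t.trunc n := by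
    rw [eq_comm (a := t.trunc n)]
    tauto
  simp only [this]

theorem dist_le {t u : ResTerm} {n : ℕ} (ht : n ≤ t.height) (hu : n ≤ u.height)
    (h : t.trunc n = u.trunc n) : dist t u ≤ twoPowNeg n :=
  iInf₂_le n ⟨ht, hu, h⟩

/-- Distances are discrete above `0`: being below `2⁻ⁿ` needs agreement at some `m ≥ n + 1`, which
then restricts to `n + 1`. -/
theorem of_dist_lt {t u : ResTerm} {n : ℕ} (h : dist t u < twoPowNeg n) :
    n + 1 ≤ t.height ∧ n + 1 ≤ u.height ∧ t.trunc (n + 1) = u.trunc (n + 1) := by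
  simp only [dist, iInf_lt_iff] at h
  obtain ⟨m, ⟨ht, hu, h⟩, hmn⟩ := h
  have hnm : n + 1 ≤ m := twoPowNeg_strictAnti.lt_iff_gt.1 hmn
  exact ⟨hnm.trans ht, hnm.trans hu, by rw [← trunc_trunc hnm t, h, trunc_trunc hnm u]⟩

end ResTerm

section Hausdorff

variable {X : Type} [LE X] {p : X → X → I}

theorem hausdorffStar_comm (hp : ∀ x y, p x y = p y x) (A B : Set X) :
    hausdorffStar p A B = hausdorffStar p B A := by
  have hp' : (fun x y => p y x) = p := funext₂ fun x y => hp y x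
  calc hausdorffStar p A B = hausdorffStar (fun x y => p y x) B A := max_comm _ _
    _ = hausdorffStar p B A := by rw [hp']

theorem hausdorffStar_le {A B : Set X} {c : I} (h : ∀ a ∈ A, ∃ a' ∈ A, a ≤ a' ∧ ∃ b ∈ B, p a' b ≤ c)
    (h' : ∀ b ∈ B, ∃ b' ∈ B, b ≤ b' ∧ ∃ a ∈ A, p a b' ≤ c) : hausdorffStar p A B ≤ c := by
  refine max_le (iSup₂_le fun a ha => ?_) (iSup₂_le fun b hb => ?_)
  · obtain ⟨a', ha', haa', b, hb, hc⟩ := h a ha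
    exact (iInf₂_le a' ⟨ha', haa'⟩).trans ((iInf₂_le b hb).trans hc)
  · obtain ⟨b', hb', hbb', a, ha, hc⟩ := h' b hb
    exact (iInf₂_le b' ⟨hb', hbb'⟩).trans ((iInf₂_le a ha).trans hc)

theorem exists_lt_of_hausdorffStar_lt {A B : Set X} {c : I} (h : hausdorffStar p A B < c) {a : X}
    (ha : a ∈ A) : ∃ a' ∈ A, a ≤ a' ∧ ∃ b ∈ B, p a' b < c := by
  have := (le_iSup₂ (f := fun (a : X) (_ : a ∈ A) =>
    ⨅ a' ∈ {a' | a' ∈ A ∧ a ≤ a'}, ⨅ b ∈ B, p a' b) a ha).trans_lt ((le_max_left _ _).trans_lt h)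
  simp only [iInf_lt_iff] at this
  obtain ⟨a', ⟨ha', haa'⟩, b, hb, hc⟩ := this
  exact ⟨a', ha', haa', b, hb, hc⟩

end Hausdorff

theorem idealDist_comm (J K : Order.Ideal ResTerm) : idealDist J K = idealDist K J :=
  hausdorffStar_comm ResTerm.dist_comm _ _

/-! ### The Taylor expansion preserves distances -/

/-- Enlarging `J` is unavoidable in general: an ideal of short terms is far from everything, since
the resource distance only counts truncation levels that both terms reach. -/
theorem exists_stable_ideal {α : BohmTree} {n : ℕ} (hn : ((n + 1 : ℕ) : ℕ∞) ≤ α.height)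
    {J : Order.Ideal ResTerm} (hJ : J ∈ taylorStar α) :
    ∃ J' ∈ taylorStar α, J ≤ J' ∧ ∃ a ∈ J', n + 1 ≤ a.height ∧
      ∀ b ∈ J', a ≤ b → b.trunc (n + 1) = a.trunc (n + 1) := by
  obtain ⟨a, ha, hmax⟩ := ResTerm.exists_trunc_eq_of_le n J.nonempty
  by_cases hh : n + 1 ≤ a.height
  · exact ⟨J, hJ, le_rfl, a, ha, hh, hmax⟩
  -- A short `a` equals its own truncation, hence so does every `c ≥ a` in `J`, which forces `c =
  -- a`. By directedness `a` is then greatest in `J`.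
  have htop : ∀ b ∈ J, b ≤ a := by
    intro b hb
    obtain ⟨c, hc, hac, hbc⟩ := J.directed a ha b hb
    have hca := hmax c hc hac
    rw [ResTerm.trunc_eq_self (t := a) (by omega)] at hca
    have hc' : ¬ n + 1 ≤ c.height := fun h => hh (hca ▸ ResTerm.le_height_trunc h)
    rw [ResTerm.trunc_eq_self (by omega)] at hca
    exact hca ▸ hbc
  obtain ⟨u, hu, hau, hnu⟩ := exists_ge_le_height hn (hJ ha)
  -- In the new ideal, any `b` above `u` is also below it, so the two have equal truncations.
  exact ⟨.principal u, principal_mem_taylorStar hu, fun b hb => (htop b hb).trans hau, u,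
    Order.Ideal.mem_principal_self, hnu, fun b hb hub => ResTerm.trunc_eq_of_le_of_le n hb hub⟩

/-- The partner of `J'` is the ideal generated by the stable truncation. Each element of `J'` is
moved above `a`, and each element of the partner up to its generator. -/
theorem exists_idealDist_le {α β : BohmTree} {n : ℕ} (h : BohmTree.TruncEq (n + 1) α β)
    {J : Order.Ideal ResTerm} (hJ : J ∈ taylorStar α) :
    ∃ J' ∈ taylorStar α, J ≤ J' ∧ ∃ K ∈ taylorStar β, idealDist J' K ≤ twoPowNeg (n + 1) := by
  obtain ⟨J', hJ', hle, a, ha, hna, hmax⟩ := exists_stable_ideal h.1 hJ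
  have hk : n + 1 ≤ (a.trunc (n + 1)).height := ResTerm.le_height_trunc hna
  refine ⟨J', hJ', hle, .principal (a.trunc (n + 1)),
    principal_mem_taylorStar (trunc_mem_taylor h.2.2 (hJ' ha)), hausdorffStar_le ?_ ?_⟩
  · intro b hb
    obtain ⟨c, hc, hbc, hac⟩ := J'.directed b hb a ha
    have hca := hmax c hc hac
    refine ⟨c, hc, hbc, _, Order.Ideal.mem_principal_self, ResTerm.dist_le ?_ hk ?_⟩
    · by_contra! hlt
      rw [ResTerm.trunc_eq_self hlt.le] at hca
      rw [← hca] at hk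
      omega
    · rw [hca, ResTerm.trunc_trunc le_rfl]
  · intro b hb
    exact ⟨_, Order.Ideal.mem_principal_self, hb, a, ha,
      ResTerm.dist_le hna hk (ResTerm.trunc_trunc le_rfl a).symm⟩

theorem hausdorffStar_taylorStar_comm (α β : BohmTree) :
    hausdorffStar idealDist (taylorStar α) (taylorStar β) =
      hausdorffStar idealDist (taylorStar β) (taylorStar α) :=
  hausdorffStar_comm idealDist_comm _ _

theorem hausdorffStar_taylorStar_le {α β : BohmTree} {n : ℕ} (h : BohmTree.TruncEq n α β) :
    hausdorffStar idealDist (taylorStar α) (taylorStar β) ≤ twoPowNeg n := by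
  rcases n with _ | n
  · rw [twoPowNeg_zero]
    exact Subtype.coe_le_coe.1 (hausdorffStar _ _ _).2.2
  · refine hausdorffStar_le (fun J hJ => exists_idealDist_le h hJ) fun K hK => ?_
    obtain ⟨K', hK', hle, J, hJ, hd⟩ := exists_idealDist_le h.symm hK
    exact ⟨K', hK', hle, J, hJ, idealDist_comm J K' ▸ hd⟩

/-- Both layers of the lifting are unfolded, starting from the principal ideal of `t`: the outer one
may enlarge this ideal, the inner one may raise `t`, and both stay inside the expansion of `α`. -/
theorem exists_trunc_eq_of_hausdorffStar_lt {α β : BohmTree} {n : ℕ}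
    (h : hausdorffStar idealDist (taylorStar α) (taylorStar β) < twoPowNeg n) {t : ResTerm}
    (ht : t ∈ taylor α) : ∃ a ∈ taylor α, t ≤ a ∧ ∃ b ∈ taylor β,
      n + 1 ≤ a.height ∧ n + 1 ≤ b.height ∧ a.trunc (n + 1) = b.trunc (n + 1) := by
  obtain ⟨J, hJ, hle, K, hK, hJK⟩ := exists_lt_of_hausdorffStar_lt h (principal_mem_taylorStar ht)
  obtain ⟨a, ha, hta, b, hb, hab⟩ :=
    exists_lt_of_hausdorffStar_lt hJK (hle Order.Ideal.mem_principal_self)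
  exact ⟨a, hJ ha, hta, b, hK hb, ResTerm.of_dist_lt hab⟩

/-- The term `t` determining `A|ₙ₊₁` from below has height at most `n + 1`, so it survives
truncation: `t = t|ₙ₊₁ ≤ a|ₙ₊₁ = b|ₙ₊₁ ≤ b`. Thus `t` lies in the expansion of some `B ∈ β`, whence
`A|ₙ₊₁ ≤ B`. -/
theorem trunc_subset_of_hausdorffStar_lt {α β : BohmTree} {n : ℕ}
    (h : hausdorffStar idealDist (taylorStar α) (taylorStar β) < twoPowNeg n) :
    BohmTree.trunc (n + 1) α ⊆ BohmTree.trunc (n + 1) β := by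
  rintro _ ⟨A, hA, rfl⟩
  -- Membership in `β` suffices because truncation is idempotent.
  suffices hmem : PartialTerm.trunc (n + 1) A ∈ β from
    ⟨_, hmem, Subtype.ext (Term.trunc_trunc _ _)⟩
  by_cases hne : A.1.trunc (n + 1) = Term.bot
  · exact (show PartialTerm.trunc (n + 1) A = ⊥ from Subtype.ext hne) ▸ β.bot_mem
  obtain ⟨t, ht, hle⟩ := Term.exists_mem_taylor_forall_le (A.1.isNormal_trunc (n + 1) A.2) hne
  obtain ⟨a, -, hta, b, ⟨B, hB, hb⟩, -, -, hab⟩ :=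
    exists_trunc_eq_of_hausdorffStar_lt h ⟨_, BohmTree.trunc_mem hA (n + 1), ht⟩
  have htn := (Term.height_le_of_mem_taylor ht).trans (Term.height_trunc_le (n + 1) A.1)
  have htb : t ≤ b := by
    rw [← ResTerm.trunc_eq_self htn]
    exact (ResTerm.trunc_mono _ hta).trans (hab.trans_le (ResTerm.trunc_le _ _))
  exact β.lower (hle B.1 (B.1.isLowerSet_taylor htb hb)) hB

theorem truncEq_of_hausdorffStar_lt {α β : BohmTree} {n : ℕ} (hα : α ≠ ⊥)
    (h : hausdorffStar idealDist (taylorStar α) (taylorStar β) < twoPowNeg n) :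
    BohmTree.TruncEq (n + 1) α β := by
  obtain ⟨t, ht⟩ := exists_mem_taylor hα
  obtain ⟨a, ha, -, b, hb, hna, hnb, -⟩ := exists_trunc_eq_of_hausdorffStar_lt h ht
  refine ⟨(Nat.cast_le.2 hna).trans (height_le_of_mem_taylor ha),
    (Nat.cast_le.2 hnb).trans (height_le_of_mem_taylor hb),
    (trunc_subset_of_hausdorffStar_lt h).antisymm (trunc_subset_of_hausdorffStar_lt ?_)⟩
  rwa [hausdorffStar_taylorStar_comm]

end BohmTaylor

open BohmTaylor in
theorem mainTheorem8 (α β : BohmTaylor.BohmTree) (h : α ≠ ⊥ ∨ β ≠ ⊥) :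
    BohmTaylor.hausdorffStar BohmTaylor.idealDist (BohmTaylor.taylorStar α)
      (BohmTaylor.taylorStar β) = BohmTaylor.treeDist α β := by
  unfold treeDist
  cases hd : BohmTree.div α β with
  | top =>
    exact eq_zero_of_forall_le_twoPowNeg fun n =>
      hausdorffStar_taylorStar_le (BohmTree.truncEq_of_div_eq_top hd n)
  | coe n =>
    obtain ⟨hn, hn'⟩ := BohmTree.truncEq_of_div_eq_coe hd
    refine le_antisymm (hausdorffStar_taylorStar_le hn) (not_lt.1 fun hlt => hn' ?_)
    -- Closeness below `2⁻ⁿ` would give agreement at `n + 1`, against the choice of `n`; by symmetry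
    -- either tree may be the nonempty one.
    rcases h with hα | hβ
    · exact truncEq_of_hausdorffStar_lt hα hlt
    · exact (truncEq_of_hausdorffStar_lt hβ (hausdorffStar_taylorStar_comm α β ▸ hlt)).symm
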